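/- Let $(t,u,z_0)\in\mathbb{Z}^3$ be a solution of $t^2-(z^2+3)u^2=1$ (with $z=z_0$) such that $3\nmid z_0$, $z_0^2+3$ is square-free and $u\neq 0$. Then $(t,u,z_0)$ does not lie on any $\mathbb{A}^1$-curve defined over $\mathbb{Z}$ on the surface $t^2-(z^2+3)u^2=1$. That is, there are no polynomials $T,U,Z\in\mathbb{Z}[x]$, not all constant, with $T(x)^2-(Z(x)^2+3)\,U(x)^2=1$ identically in $x$ and $(T(s),U(s),Z(s))=(t,u,z_0)$ for some $s\in\mathbb{C}$ (in particular, for no $s\in\mathbb{Z}$). -/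

import Mathlib

/-- The `R`-points `(t, u, z)` of the affine surface `t² - (z² + 3) u² = 1`. -/
def pellSurface (R : Type*) [CommRing R] : Set (R × R × R) :=
  {P | P.1 ^ 2 - (P.2.2 ^ 2 + 3) * P.2.1 ^ 2 = 1}

/-- An `𝔸¹`-curve defined over `ℤ` on the surface `t² - (z² + 3) u² = 1`: a non-constant morphism
from the affine line over `ℤ` to the surface, i.e. a `ℤ[X]`-point of the surface (three integer
polynomials satisfying the equation identically) whose coordinates are not all constant. -/
structure A1Curve where
  /-- the `t`-coordinate of the parametrization -/
  t : Polynomial ℤ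
  /-- the `u`-coordinate of the parametrization -/
  u : Polynomial ℤ
  /-- the `z`-coordinate of the parametrization -/
  z : Polynomial ℤ
  mem_surface : (t, u, z) ∈ pellSurface (Polynomial ℤ)
  nonconstant : ¬ ∃ a b c : ℤ, t = Polynomial.C a ∧ u = Polynomial.C b ∧ z = Polynomial.C c

/-- The integer point `P = (t, u, z)` lies on the curve `φ`, i.e. on its image: `P = φ(s)` for some
geometric (complex) point `s` of the affine line. In particular this holds whenever `P = φ(n)`
for an integer `n`. -/
def A1Curve.Contains (φ : A1Curve) (P : ℤ × ℤ × ℤ) : Prop :=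
  ∃ s : ℂ, Polynomial.aeval s φ.t = (P.1 : ℂ) ∧ Polynomial.aeval s φ.u = (P.2.1 : ℂ) ∧
    Polynomial.aeval s φ.z = (P.2.2 : ℂ)

/-! Put D = Z² + 3. If Z is constant, then T² - D U² factors over ℂ into units, so T and U are
constant too. Otherwise Z ± √D has norm -3, a unit over ℂ, and descent on the degree of U
(`exists_eq_pellPow_of_pell`) gives T + U√D = a(Z ± √D)^n with a²(-3)^n = 1, up to conjugation and
sign. At the given point this yields u²(-3)^n = v², where v is the √-coordinate of (z₀ + √(z₀² +
3))^n. If n = 0 then u = 0. If n > 0 then 3 ∣ v, whereas v ≡ (2z₀)^(n-1) mod 3 is nonzero. -/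

/-- The coordinates of `(z + √(z² + 3)) ^ n` with respect to `1, √(z² + 3)`. -/
def pellPow {R : Type*} [CommRing R] (z : R) : ℕ → R × R
  | 0 => (1, 0)
  | n + 1 => (z * (pellPow z n).1 + (z ^ 2 + 3) * (pellPow z n).2,
      (pellPow z n).1 + z * (pellPow z n).2)

theorem pellPow_norm {R : Type*} [CommRing R] (z : R) (n : ℕ) :
    (pellPow z n).1 ^ 2 - (z ^ 2 + 3) * (pellPow z n).2 ^ 2 = (-3) ^ n := by
  induction n with
  | zero => simp [pellPow]
  | succ n ih =>
    simp only [pellPow]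
    rw [pow_succ (-3 : R), ← ih]
    ring

theorem map_pellPow {R S : Type*} [CommRing R] [CommRing S] (f : R →+* S) (z : R) (n : ℕ) :
    f (pellPow z n).1 = (pellPow (f z) n).1 ∧ f (pellPow z n).2 = (pellPow (f z) n).2 := by
  induction n with
  | zero => simp [pellPow]
  | succ n ih =>
    have h3 : f 3 = 3 := map_ofNat f 3
    simp [pellPow, ih.1, ih.2, h3]

/-- When 3 = 0, w = √(z² + 3) satisfies w² = z², hence (z + w)² = 2z(z + w). -/
theorem pellPow_succ_of_three_eq_zero {R : Type*} [CommRing R] (h : (3 : R) = 0) (z : R) (n : ℕ) :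
    pellPow z (n + 1) = ((2 * z) ^ n * z, (2 * z) ^ n) := by
  induction n with
  | zero => simp [pellPow]
  | succ n ih =>
    rw [pellPow, ih, h]
    ext <;> ring

theorem not_three_dvd_pellPow_succ {z : ℤ} (hz : ¬ (3 : ℤ) ∣ z) (n : ℕ) :
    ¬ (3 : ℤ) ∣ (pellPow z (n + 1)).2 := by
  have h2 : (2 : ZMod 3) ≠ 0 := by decide
  have : Fact (Nat.Prime 3) := ⟨Nat.prime_three⟩
  intro h
  have hz' : (z : ZMod 3) ≠ 0 := fun h0 => hz ((ZMod.intCast_zmod_eq_zero_iff_dvd z 3).1 h0)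
  have h' := (ZMod.intCast_zmod_eq_zero_iff_dvd _ 3).2 h
  have hmap := (map_pellPow (Int.castRingHom (ZMod 3)) z (n + 1)).2
  rw [pellPow_succ_of_three_eq_zero (R := ZMod 3) (by decide), eq_intCast, eq_intCast, h'] at hmap
  exact pow_ne_zero n (mul_ne_zero h2 hz') hmap.symm

open Polynomial in
/-- One of the two conjugate descent steps lowers the degree of the second coordinate. -/
theorem degree_lt_or_degree_lt_of_pell {K : Type*} [Field K] [CharZero K] {T U Z : K[X]} {c : K}
    (hZ : 0 < Z.natDegree) (hU : U ≠ 0) (h : T ^ 2 - (Z ^ 2 + 3) * U ^ 2 = C c) :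
    (U * Z - T).degree < U.degree ∨ (U * Z + T).degree < U.degree := by
  by_contra! hcon
  obtain ⟨h1, h2⟩ := hcon
  have hP : U * Z - T ≠ 0 := fun h0 => hU (by simpa [h0] using h1)
  have hQ : U * Z + T ≠ 0 := fun h0 => hU (by simpa [h0] using h2)
  have hZ0 : Z ≠ 0 := by rintro rfl; simp at hZ
  have h1' := natDegree_le_natDegree h1
  have h2' := natDegree_le_natDegree h2
  -- The product forces both factors to have degree at most that of U, but their sum 2UZ has larger
  -- degree.
  have hprod : (U * Z - T) * (U * Z + T) = C (-c) - C 3 * U ^ 2 := by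
    rw [C_neg, ← h, show (C 3 : K[X]) = 3 from rfl]
    ring
  have hle : ((U * Z - T) * (U * Z + T)).natDegree ≤ 2 * U.natDegree := by
    rw [hprod]
    refine (natDegree_sub_le _ _).trans (max_le (by simp) ?_)
    exact (natDegree_C_mul_le _ _).trans natDegree_pow_le
  rw [natDegree_mul hP hQ] at hle
  have hsum : (U * Z - T) + (U * Z + T) = C 2 * (U * Z) := by
    rw [show (C 2 : K[X]) = 2 from rfl]
    ring
  have hdeg := natDegree_add_le (U * Z - T) (U * Z + T)
  rw [hsum, natDegree_C_mul two_ne_zero, natDegree_mul hU hZ0] at hdeg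
  have := le_max_iff.1 hdeg
  omega

open Polynomial in
/-- The polynomial Pell equation `T² - (Z² + 3) U² = c` with `Z` nonconstant is solved only by
the multiples of powers of `Z ± √(Z² + 3)`. -/
theorem exists_eq_pellPow_of_pell {K : Type*} [Field K] [CharZero K] {Z : K[X]}
    (hZ : 0 < Z.natDegree) {T U : K[X]} {c : K} (h : T ^ 2 - (Z ^ 2 + 3) * U ^ 2 = C c) :
    ∃ (a b : K) (n : ℕ), (b = a ∨ b = -a) ∧
      T = C a * (pellPow Z n).1 ∧ U = C b * (pellPow Z n).2 := by
  obtain ⟨N, hN⟩ : ∃ N : ℕ, U.degree < N :=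
    ⟨U.natDegree + 1, degree_le_natDegree.trans_lt (by exact_mod_cast Nat.lt_succ_self _)⟩
  induction N generalizing T U c with
  | zero =>
    have hU : U = 0 := by
      rw [← degree_eq_bot]
      exact Nat.WithBot.lt_zero_iff.1 (by exact_mod_cast hN)
    subst hU
    have hT : T.natDegree = 0 := by
      have := congrArg natDegree h
      simpa using this
    exact ⟨T.coeff 0, T.coeff 0, 0, Or.inl rfl,
      by simpa [pellPow] using eq_C_of_natDegree_eq_zero hT, by simp [pellPow]⟩
  | succ N ih =>
    by_cases hU : U = 0
    · exact ih h (by simp [hU, bot_lt_iff_ne_bot])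
    have key : ∀ T : K[X], T ^ 2 - (Z ^ 2 + 3) * U ^ 2 = C c → (U * Z - T).degree < U.degree →
        ∃ (a b : K) (n : ℕ), (b = a ∨ b = -a) ∧
          T = C a * (pellPow Z n).1 ∧ U = C b * (pellPow Z n).2 := by
      intro T h hlt
      have hN' : (U * Z - T).degree < N := by
        refine hlt.trans_le ?_
        rw [degree_eq_natDegree hU] at hN ⊢
        have : U.natDegree < N + 1 := by exact_mod_cast hN
        exact_mod_cast Nat.lt_succ_iff.1 this
      -- Descent: multiply T + U√D by Z - √D, of norm -3. Multiplying back by Z + √D gives `hT3` and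
      -- `hU3`.
      have h' : (T * Z - U * (Z ^ 2 + 3)) ^ 2 - (Z ^ 2 + 3) * (U * Z - T) ^ 2 = C (-3 * c) := by
        rw [C_mul, ← h, C_neg, show (C 3 : K[X]) = 3 from rfl]
        ring
      obtain ⟨a, b, n, hab, hT, hU'⟩ := ih h' hN'
      have h3 : (3 : K[X]) ≠ 0 := C_ne_zero.2 (three_ne_zero : (3 : K) ≠ 0)
      have hT3 : 3 * T = -((T * Z - U * (Z ^ 2 + 3)) * Z + (U * Z - T) * (Z ^ 2 + 3)) := by ring
      have hU3 : 3 * U = -((T * Z - U * (Z ^ 2 + 3)) + (U * Z - T) * Z) := by ring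
      rw [hT, hU'] at hT3 hU3
      have hC : ∀ x : K, (3 : K[X]) * C (-x / 3) = -C x := by
        intro x
        rw [show (3 : K[X]) = C 3 from rfl, ← C_mul, ← C_neg]
        congr 1
        field_simp
      -- Same sign: the exponent rises. For n = 0 the second coordinate vanishes, so the sign of b
      -- is immaterial.
      have up : b = a ∨ n = 0 → ∃ (a b : K) (n : ℕ), (b = a ∨ b = -a) ∧
          T = C a * (pellPow Z n).1 ∧ U = C b * (pellPow Z n).2 := by
        intro hcase
        have hB : C b * (pellPow Z n).2 = C a * (pellPow Z n).2 := by
          rcases hcase with rfl | rfl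
          · rfl
          · simp [pellPow]
        rw [hB] at hT3 hU3
        refine ⟨-a / 3, -a / 3, n + 1, Or.inl rfl, mul_left_cancel₀ h3 ?_, mul_left_cancel₀ h3 ?_⟩
        · rw [hT3, ← mul_assoc, hC, pellPow]
          ring
        · rw [hU3, ← mul_assoc, hC, pellPow]
          ring
      rcases hab with hab | hab
      · exact up (Or.inl hab)
      · rcases n with _ | m
        · exact up (Or.inr rfl)
        -- Opposite sign: Z + √D cancels one factor Z - √D, so the exponent drops.
        · subst hab
          refine ⟨a, -a, m, Or.inr rfl, mul_left_cancel₀ h3 ?_, mul_left_cancel₀ h3 ?_⟩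
          · rw [hT3, pellPow, C_neg]
            ring
          · rw [hU3, pellPow, C_neg]
            ring
    rcases degree_lt_or_degree_lt_of_pell hZ hU h with hlt | hlt
    · exact key T h hlt
    · obtain ⟨a, b, n, hab, hT, hU'⟩ := key (-T) (by rw [neg_sq]; exact h)
        (by rwa [sub_neg_eq_add])
      refine ⟨-a, b, n, ?_, ?_, hU'⟩
      · rw [neg_neg]
        exact hab.symm
      · rw [C_neg, neg_mul, ← hT, neg_neg]

open Polynomial in
/-- The equation `T² - d U² = 1` with `d ≠ 0` constant has only constant solutions. -/
theorem natDegree_eq_zero_of_pell_const {T U : ℂ[X]} {d : ℂ} (hd : d ≠ 0)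
    (h : T ^ 2 - C d * U ^ 2 = 1) : T.natDegree = 0 ∧ U.natDegree = 0 := by
  obtain ⟨w, hw⟩ := IsAlgClosed.exists_pow_nat_eq d two_pos
  have hw0 : w ≠ 0 := by
    rintro rfl
    exact hd (by simpa using hw.symm)
  have hprod : (T - C w * U) * (T + C w * U) = 1 := by
    rw [← h, ← hw, C_pow]
    ring
  have hm := natDegree_eq_zero_of_isUnit (IsUnit.of_mul_eq_one _ hprod)
  have hp := natDegree_eq_zero_of_isUnit (IsUnit.of_mul_eq_one _ ((mul_comm _ _).trans hprod))
  have hT : C 2 * T = (T - C w * U) + (T + C w * U) := by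
    rw [show (C 2 : ℂ[X]) = 2 from rfl]
    ring
  have hU : C (2 * w) * U = (T + C w * U) - (T - C w * U) := by
    rw [C_mul, show (C 2 : ℂ[X]) = 2 from rfl]
    ring
  constructor
  · rw [← natDegree_C_mul (p := T) (two_ne_zero (α := ℂ)), hT]
    exact Nat.le_zero.1 ((natDegree_add_le _ _).trans (by simp [hm, hp]))
  · rw [← natDegree_C_mul (p := U) (mul_ne_zero (two_ne_zero (α := ℂ)) hw0), hU]
    exact Nat.le_zero.1 ((natDegree_sub_le _ _).trans (by simp [hm, hp]))

theorem proposition3p1 (t u z₀ : ℤ) (hsol : (t, u, z₀) ∈ pellSurface ℤ)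
    (h3 : ¬ (3 : ℤ) ∣ z₀) (hsf : Squarefree (z₀ ^ 2 + 3)) (hu : u ≠ 0) :
    ¬ ∃ φ : A1Curve, φ.Contains (t, u, z₀) := by
  rintro ⟨⟨T, U, Z, hmem, hnc⟩, s, -, hsu, hsz⟩
  simp only at hsu hsz
  have hmem : T ^ 2 - (Z ^ 2 + 3) * U ^ 2 = 1 := hmem
  have hinj : Function.Injective (Int.castRingHom ℂ) := Int.cast_injective
  have hpoly : (T.map (Int.castRingHom ℂ)) ^ 2 - ((Z.map (Int.castRingHom ℂ)) ^ 2 + 3) *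
      (U.map (Int.castRingHom ℂ)) ^ 2 = 1 := by
    simpa using congrArg (Polynomial.map (Int.castRingHom ℂ)) hmem
  rw [Polynomial.aeval_def, ← Polynomial.eval_map] at hsu hsz
  change Polynomial.eval s (U.map (Int.castRingHom ℂ)) = _ at hsu
  change Polynomial.eval s (Z.map (Int.castRingHom ℂ)) = _ at hsz
  rcases Nat.eq_zero_or_pos Z.natDegree with hZ | hZ
  · rw [Polynomial.eq_C_of_natDegree_eq_zero hZ, Polynomial.map_C] at hsz hpoly
    rw [Polynomial.eval_C] at hsz
    have hd : ((z₀ : ℂ) ^ 2 + 3) ≠ 0 := by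
      have : z₀ ^ 2 + 3 ≠ 0 := by positivity
      exact_mod_cast this
    rw [hsz] at hpoly
    obtain ⟨hT, hU⟩ := natDegree_eq_zero_of_pell_const hd (by simpa [show (Polynomial.C 3 : Polynomial ℂ) = 3 from rfl] using hpoly)
    rw [Polynomial.natDegree_map_eq_of_injective hinj] at hT hU
    exact hnc ⟨_, _, _, Polynomial.eq_C_of_natDegree_eq_zero hT,
      Polynomial.eq_C_of_natDegree_eq_zero hU, Polynomial.eq_C_of_natDegree_eq_zero hZ⟩
  · rw [← Polynomial.natDegree_map_eq_of_injective hinj] at hZ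
    obtain ⟨a, b, n, hab, hT, hU⟩ := exists_eq_pellPow_of_pell hZ (c := 1) (by simpa using hpoly)
    have hba : b ^ 2 = a ^ 2 := by rcases hab with rfl | rfl <;> ring
    have hnorm : a ^ 2 * (-3) ^ n = 1 := by
      have hn := pellPow_norm (Z.map (Int.castRingHom ℂ)) n
      rw [hT, hU] at hpoly
      apply Polynomial.C_injective
      simp only [map_mul, map_pow, map_neg, map_one]
      rw [show (Polynomial.C 3 : Polynomial ℂ) = 3 from rfl, ← hn, ← hpoly, mul_pow, mul_pow,
        ← Polynomial.C_pow (a := b), hba, Polynomial.C_pow]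
      ring
    have heval : (u : ℂ) = b * ((pellPow z₀ n).2 : ℤ) := by
      rw [← hsu, hU, Polynomial.eval_mul, Polynomial.eval_C, ← Polynomial.coe_evalRingHom,
        (map_pellPow (Polynomial.evalRingHom s) _ n).2, Polynomial.coe_evalRingHom, hsz,
        ← eq_intCast (Int.castRingHom ℂ) (pellPow z₀ n).2,
        (map_pellPow (Int.castRingHom ℂ) z₀ n).2, eq_intCast]
    -- Squaring eliminates the complex scalar b, since b²(-3)^n = 1, and leaves an identity in ℤ.
    have hsq : u ^ 2 * (-3) ^ n = (pellPow z₀ n).2 ^ 2 := by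
      have : (u : ℂ) ^ 2 * (-3) ^ n = ((pellPow z₀ n).2 : ℤ) ^ 2 := by
        rw [heval, mul_pow, hba, mul_right_comm, hnorm, one_mul]
      exact_mod_cast this
    rcases n with _ | n
    · simp [pellPow] at hsq
      exact hu hsq
    · refine not_three_dvd_pellPow_succ h3 n (Int.prime_three.dvd_of_dvd_pow (n := 2) ?_)
      rw [← hsq, pow_succ]
      exact ⟨-(u ^ 2 * (-3) ^ n), by ring⟩
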